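/- **Theorem.** Let $X$ be a locally wep-connected topological space and let $F\colon \pi^{\tau}X\to\mathbf{Set}$ be a $\mathbf{Top}$-functor. Then the projection $p_F\colon \tilde X_F\to X$ is a semicovering map. Here $I=[0,1]$; for a space $X$, $\mathcal PX$ is the set of paths $I\to X$ with the compact-open topology; $(\mathcal PX)_x=\{\alpha\in\mathcal PX : \alpha(0)=x\}$ and $\mathcal PX(x_1,x_2)=\{\alpha\in\mathcal PX:\alpha(0)=x_1,\ \alpha(1)=x_2\}$ are subspaces. * *Locally wep-connected.* A path $\alpha$ is *well-ended* (resp. *locally well-ended*) if for every open neighborhood $U$ of $\alpha$ in $\mathcal PX$ there are open neighborhoods $V_0$ of $\alpha(0)$ and $V_1$ of $\alpha(1)$ in $X$ such that for all $a\in V_0$, $b\in V_1$ there is a path (resp. a well-ended path) $\beta\in U$ with $\beta(0)=a$ and $\beta(1)=b$. The space $X$ is *locally wep-connected* if every pair of points of $X$ can be connected by a locally well-ended path. * *The fundamental $\mathbf{Top}$-groupoid.* A $\mathbf{Top}$-groupoid is a groupoid whose hom-sets carry topologies for which all compositions are jointly continuous and all inversions are continuous. $\pi^{\tau}X$ is the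 fundamental groupoid $\pi X$ with the finest $\mathbf{Top}$-groupoid structure that is coarser than $\pi^{qtop}X$, i.e. the fundamental groupoid in which each hom-set $\pi X(x_1,x_2)$ has the quotient topology from $\mathcal PX(x_1,x_2)$. (It is the value on $\pi^{qtop}X$ of the left adjoint to the inclusion of $\mathbf{Top}$-groupoids.) * *$\mathbf{Top}$-functors to $\mathbf{Set}$.* A functor $F\colon\pi^{\tau}X\to\mathbf{Set}$ is a $\mathbf{Top}$-functor if each map $\pi^{\tau}X(x_1,x_2)\to\mathbf{Set}(F(x_1),F(x_2))$ is continuous, where $\mathbf{Set}(A,B)$ has the topology of pointwise convergence with $B$ discrete. * *The space $\tilde X_F$.* As a set, $\tilde X_F$ is the disjoint union $\bigsqcup_{x\in X}F(x)$, and $p_F$ sends the elements of $F(x)$ to $x$. It has the quotient topology with respect to $$\Theta_F\colon\coprod_{x\in X}F(x)\times(\mathcal PX)_x\to\tilde X_F,\qquad \Theta_F(y,\alpha)=F([\alpha])(y)\in F(\alpha(1)),$$ where each $F(x)$ is discrete. With this topology $p_F$ is continuous. * *Semicovering map.* A continuous map $p\colon Y\to X$ is a *semicovering map* if it is a local homeomorphism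 and, for every $y\in Y$, both maps $$\mathcal Pp\colon(\mathcal PY)_y\to(\mathcal PX)_{p(y)},\ \alpha\mapsto p\circ\alpha,\qquad \Phi p\colon(\Phi Y)_y\to(\Phi X)_{p(y)},\ \phi\mapsto p\circ\phi,$$ are homeomorphisms. Here $(\Phi X)_x$ is the space, with the compact-open topology, of continuous maps $\phi\colon\Delta_2\to X$ on the simplex $\Delta_2=\{(s,t)\in I^2: s+t\le 1\}$ that send the edge $\{s=0\}$ to $x$. -/

import Mathlib

open CategoryTheory Topology
open scoped unitInterval

universe u v w

namespace SemicoveringTheory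

noncomputable section

/-! ### Path spaces and spaces of homotopies -/

/-- The space `(𝒫X)_x` of paths in `X` starting at `x`, a subspace of the path space
`𝒫X = C(I, X)` with the compact-open topology. -/
abbrev PathsFrom (X : Type u) [TopologicalSpace X] (x : X) : Type u :=
  {α : C(I, X) // α 0 = x}

/-- The standard 2-simplex `Δ₂ = {(s, t) ∈ I² | s + t ≤ 1}`. -/
abbrev Simplex2 : Type :=
  {q : I × I // (q.1 : ℝ) + (q.2 : ℝ) ≤ 1}

/-- The space `(ΦX)_x` of maps of pairs `(Δ₂, e₁) → (X, {x})` with the compact-open topology, where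
`e₁ = {(s, t) ∈ Δ₂ | s = 0}` is the edge opposite to the vertex `(1, 0)`. -/
abbrev HomotopiesFrom (X : Type u) [TopologicalSpace X] (x : X) : Type u :=
  {φ : C(Simplex2, X) // ∀ q : Simplex2, q.1.1 = 0 → φ q = x}

/-- The map `𝒫p : (𝒫Y)_y → (𝒫X)_{p(y)}`, `α ↦ p ∘ α`. -/
def pathsFromMap {Y : Type v} {X : Type u} [TopologicalSpace Y] [TopologicalSpace X]
    (p : C(Y, X)) (y : Y) (α : PathsFrom Y y) : PathsFrom X (p y) :=
  ⟨p.comp α.1, congrArg p α.2⟩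

/-- The map `Φp : (ΦY)_y → (ΦX)_{p(y)}`, `φ ↦ p ∘ φ`. -/
def homotopiesFromMap {Y : Type v} {X : Type u} [TopologicalSpace Y] [TopologicalSpace X]
    (p : C(Y, X)) (y : Y) (φ : HomotopiesFrom Y y) : HomotopiesFrom X (p y) :=
  ⟨p.comp φ.1, fun q hq => congrArg p (φ.2 q hq)⟩

/-! ### Semicovering maps -/

/-- `p` has continuous lifting of paths. -/
def HasContinuousLiftingOfPaths {Y : Type v} {X : Type u} [TopologicalSpace Y]
    [TopologicalSpace X] (p : C(Y, X)) : Prop :=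
  ∀ y : Y, IsHomeomorph (pathsFromMap p y)

/-- `p` has continuous lifting of homotopies. -/
def HasContinuousLiftingOfHomotopies {Y : Type v} {X : Type u} [TopologicalSpace Y]
    [TopologicalSpace X] (p : C(Y, X)) : Prop :=
  ∀ y : Y, IsHomeomorph (homotopiesFromMap p y)

/-- A semicovering map is a local homeomorphism with continuous lifting of paths and homotopies. -/
structure IsSemicoveringMap {Y : Type v} {X : Type u} [TopologicalSpace Y]
    [TopologicalSpace X] (p : C(Y, X)) : Prop where
  isLocalHomeomorph : IsLocalHomeomorph p
  liftingOfPaths : HasContinuousLiftingOfPaths p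
  liftingOfHomotopies : HasContinuousLiftingOfHomotopies p

/-! ### Locally wep-connected spaces -/

/-- A path `α` is well-ended if for every open neighborhood `U` of `α` in `𝒫X` there are open
neighborhoods `V₀`, `V₁` of its endpoints such that all `a ∈ V₀`, `b ∈ V₁` are joined by a path
in `U`. -/
def IsWellEnded {X : Type u} [TopologicalSpace X] (α : C(I, X)) : Prop :=
  ∀ U : Set C(I, X), IsOpen U → α ∈ U →
    ∃ V₀ V₁ : Set X, IsOpen V₀ ∧ IsOpen V₁ ∧ α 0 ∈ V₀ ∧ α 1 ∈ V₁ ∧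
      ∀ a ∈ V₀, ∀ b ∈ V₁, ∃ β ∈ U, β 0 = a ∧ β 1 = b

/-- A path `α` is locally well-ended if for every open neighborhood `U` of `α` in `𝒫X` there are
open neighborhoods `V₀`, `V₁` of its endpoints such that all `a ∈ V₀`, `b ∈ V₁` are joined by a
well-ended path in `U`. -/
def IsLocallyWellEnded {X : Type u} [TopologicalSpace X] (α : C(I, X)) : Prop :=
  ∀ U : Set C(I, X), IsOpen U → α ∈ U →
    ∃ V₀ V₁ : Set X, IsOpen V₀ ∧ IsOpen V₁ ∧ α 0 ∈ V₀ ∧ α 1 ∈ V₁ ∧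
      ∀ a ∈ V₀, ∀ b ∈ V₁, ∃ β ∈ U, IsWellEnded β ∧ β 0 = a ∧ β 1 = b

/-- `X` is locally wep-connected if every pair of points is joined by a locally well-ended path. -/
def IsLocallyWepConnected (X : Type u) [TopologicalSpace X] : Prop :=
  ∀ x₀ x₁ : X, ∃ α : C(I, X), IsLocallyWellEnded α ∧ α 0 = x₀ ∧ α 1 = x₁

/-! ### `Top`-groupoids, `Top`-functors and the reflection `τ` -/

/-- A choice of a topology on each hom-set of `C`. -/
abbrev HomTopology (C : Type u) [Category.{v} C] : Type (max u v) :=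
  ∀ x y : C, TopologicalSpace (x ⟶ y)

/-- A functor is a `Top`-functor, with respect to given topologies on the hom-sets, if it is
continuous on each hom-set. -/
def IsTopFunctor {C : Type*} [Category C] {D : Type*} [Category D]
    (S : HomTopology C) (T : HomTopology D) (F : C ⥤ D) : Prop :=
  ∀ x y : C, Continuous[S x y, T (F.obj x) (F.obj y)] (fun f : x ⟶ y => F.map f)

/-- A groupoid with topologies on its hom-sets is a `Top`-groupoid if all composition maps are
jointly continuous and all inversion maps are continuous. -/
structure IsTopGroupoid {G : Type u} [Groupoid.{v} G] (T : HomTopology G) : Prop where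
  continuous_comp : ∀ x y z : G,
    @Continuous ((x ⟶ y) × (y ⟶ z)) (x ⟶ z)
      (@instTopologicalSpaceProd _ _ (T x y) (T y z)) (T x z) (fun f => f.1 ≫ f.2)
  continuous_inv : ∀ x y : G,
    Continuous[T x y, T y x] (fun f : x ⟶ y => Groupoid.inv f)

/-- The finest `Top`-groupoid structure `τ(T)` on `G` which is coarser than `T`: the infimum below
is the topology generated by all sets which are open in some `Top`-groupoid structure coarser than
`T`. The next three facts say that `G ↦ τ(G)` is the left adjoint, identical on underlying
groupoids, to the inclusion of `Top`-groupoids. -/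
@[reducible] def tau {G : Type u} [Groupoid.{v} G] (T : HomTopology G) : HomTopology G :=
  fun x y => ⨅ S : {S : HomTopology G // IsTopGroupoid S ∧ ∀ a b : G, T a b ≤ S a b}, S.1 x y

theorem isTopGroupoid_tau {G : Type u} [Groupoid.{v} G] (T : HomTopology G) :
    IsTopGroupoid (tau T) where
  continuous_comp x y z := by
    refine continuous_iInf_rng.2 fun S => ?_
    have h := S.2.1.continuous_comp x y z
    refine continuous_le_dom ?_ h
    exact inf_le_inf (induced_mono (iInf_le _ S)) (induced_mono (iInf_le _ S))
  continuous_inv x y := by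
    refine continuous_iInf_rng.2 fun S => ?_
    exact continuous_le_dom (iInf_le _ S) (S.2.1.continuous_inv x y)

theorem le_tau {G : Type u} [Groupoid.{v} G] (T : HomTopology G) (x y : G) :
    T x y ≤ tau T x y :=
  le_iInf fun S => S.2.2 x y

theorem isTopFunctor_tau {G : Type u} [Groupoid.{v} G] (T : HomTopology G)
    {H : Type*} [Groupoid H] {S : HomTopology H} (hS : IsTopGroupoid S) {F : G ⥤ H}
    (hF : IsTopFunctor T S F) : IsTopFunctor (tau T) S F := by
  have key : IsTopGroupoid
      (fun x y : G => (S (F.obj x) (F.obj y)).induced (fun f : x ⟶ y => F.map f)) := by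
    constructor
    · intro x y z
      let := S (F.obj x) (F.obj y)
      let := S (F.obj y) (F.obj z)
      let := S (F.obj x) (F.obj z)
      let : TopologicalSpace (x ⟶ y) := .induced (fun f => F.map f) inferInstance
      let : TopologicalSpace (y ⟶ z) := .induced (fun f => F.map f) inferInstance
      refine continuous_induced_rng.2 ?_
      have h := (hS.continuous_comp (F.obj x) (F.obj y) (F.obj z)).comp
        ((continuous_induced_dom (f := fun f : x ⟶ y => F.map f)).prodMap
          (continuous_induced_dom (f := fun f : y ⟶ z => F.map f)))
      refine h.congr fun f => ?_
      simp
    · intro x y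
      let := S (F.obj x) (F.obj y)
      let := S (F.obj y) (F.obj x)
      let : TopologicalSpace (x ⟶ y) := .induced (fun f => F.map f) inferInstance
      refine continuous_induced_rng.2 ?_
      have h := (hS.continuous_inv (F.obj x) (F.obj y)).comp
        (continuous_induced_dom (f := fun f : x ⟶ y => F.map f))
      refine h.congr fun f => ?_
      simp [Groupoid.inv_eq_inv]
  intro x y
  refine continuous_iff_le_induced.2 (iInf_le_of_le ⟨_, key, fun a b => ?_⟩ le_rfl)
  exact continuous_iff_le_induced.1 (hF a b)

/-! ### The fundamental `Top`-groupoid and the `Top`-category of sets -/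

/-- The hom-topologies of `π^qtop X`: each `πX(x₀, x₁)` is a quotient of the path space
`𝒫X(x₀, x₁)` under the map identifying homotopy classes of paths. -/
@[reducible] def fundamentalQTop (X : Type u) [TopologicalSpace X] : HomTopology (FundamentalGroupoid X) :=
  fun x y => TopologicalSpace.coinduced
    (fun γ : Path x.as y.as => (Path.Homotopic.Quotient.mk γ : x ⟶ y)) inferInstance

/-- The hom-topologies of the fundamental `Top`-groupoid `π^τ X = τ(π^qtop X)`. -/
@[reducible] def fundamentalTau (X : Type u) [TopologicalSpace X] : HomTopology (FundamentalGroupoid X) :=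
  tau (fundamentalQTop X)

/-- The category of sets as a `Top`-category: sets of functions carry the topology of pointwise
convergence, where the codomain is discrete. -/
@[reducible] def pointwiseTopology : HomTopology (Type w) :=
  fun A B => ⨅ a : A, TopologicalSpace.induced (fun f : A ⟶ B => f a) (⊥ : TopologicalSpace B)

/-! ### The space `X̃_F` and the projection `p_F` -/

variable {X : Type u} [TopologicalSpace X]

/-- The underlying set `⋃_{x ∈ X} F(x)` (disjoint union) of the space `X̃_F`. -/
def TildeSpace (F : FundamentalGroupoid X ⥤ Type w) : Type (max u w) :=
  Σ x : X, F.obj ⟨x⟩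

/-- The homotopy class `[α]`, a morphism from `x` to `α(1)`, of a path `α` starting at `x`. -/
def homotopyClass {x : X} (α : PathsFrom X x) :
    FundamentalGroupoid.mk x ⟶ FundamentalGroupoid.mk (α.1 1) :=
  FundamentalGroupoid.fromPath (Path.Homotopic.Quotient.mk
    { toContinuousMap := α.1, source' := α.2, target' := rfl })

/-- The map `Θ_F : ∐_x F(x) × (𝒫X)_x → X̃_F`, `(y, α) ↦ y · [α] = F([α])(y) ∈ F(α(1))`. -/
def Theta (F : FundamentalGroupoid X ⥤ Type w) :
    (Σ x : X, F.obj ⟨x⟩ × PathsFrom X x) → TildeSpace F :=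
  fun z => ⟨z.2.2.1 1, F.map (homotopyClass z.2.2) z.2.1⟩

/-- The topology of `∐_x F(x) × (𝒫X)_x`, where each `F(x)` is discrete. -/
@[reducible] def sourceTopology (F : FundamentalGroupoid X ⥤ Type w) :
    TopologicalSpace (Σ x : X, F.obj ⟨x⟩ × PathsFrom X x) :=
  letI : ∀ x : X, TopologicalSpace (F.obj ⟨x⟩) := fun _ => ⊥
  inferInstance

/-- `X̃_F` carries the quotient topology with respect to `Θ_F`. -/
instance tildeSpaceTopology (F : FundamentalGroupoid X ⥤ Type w) :
    TopologicalSpace (TildeSpace F) :=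
  TopologicalSpace.coinduced (Theta F) (sourceTopology F)

theorem continuous_tildeProj (F : FundamentalGroupoid X ⥤ Type w) :
    Continuous (fun z : TildeSpace F => z.1) := by
  refine continuous_coinduced_dom.2 ?_
  let : ∀ x : X, TopologicalSpace (F.obj ⟨x⟩) := fun _ => ⊥
  change Continuous (fun z : (Σ x : X, F.obj ⟨x⟩ × PathsFrom X x) => z.2.2.1 1)
  refine continuous_sigma fun x => ?_
  exact (continuous_eval_const (1 : I)).comp
    (continuous_subtype_val.comp continuous_snd)

/-- The projection `p_F : X̃_F → X`, sending `F(x)` to `x`. -/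
def tildeProj (F : FundamentalGroupoid X ⥤ Type w) : C(TildeSpace F, X) :=
  ⟨fun z => z.1, continuous_tildeProj F⟩

end

end SemicoveringTheory

/-!
A functor `F` on the fundamental groupoid transports a point `y ∈ F(a)` along a path `γ` from `a`
to `b` to a point of `F(b)`. Continuity of `F` says that this transport is locally constant in `γ`
as long as both endpoints are fixed. Applied to the composite of `γ` with the inverse of a second
path `δ`, it also controls paths with a moving common endpoint: if `y` along `γ` and `y'` along `δ`
are transported to the same point, then the same holds for all nearby pairs of paths with a common
endpoint (`exists_isOpen_transport_eq`).

Fix a locally well-ended path `α` from `x₀` to `x` and `y ∈ F(x₀)`. By the preceding remark, paths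
near `α` from `x₀` to a point `b` near `x` all transport `y` to the same point of `F(b)`, so that
they sweep out a subset of the total space on which the projection is injective (`sheet`). It is
open because every `b` near `x` is reached by a *well-ended* path near `α` (`isOpen_sheet`). The
sheets of distinct points of `F(x₀)` along the same paths are disjoint, because transport is
bijective; hence the projection is a separated map (`isSeparatedMap_tildeProj`). It is also locally
injective and open, thus a local homeomorphism.

Since the projection is separated and locally injective, lifts of maps from connected spaces are
unique. A lift of a path `α` starting at `y` is `t ↦ Θ(y, α|[0, t])`, and a lift of a homotopy `φ`
is `(s, t) ↦ Θ(y, u ↦ φ(us, t))`. These depend continuously on `α` and `φ` by the exponential law,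
`Θ` being continuous by definition.
-/

namespace SemicoveringTheory

noncomputable section

variable {X : Type u} [TopologicalSpace X]

/-! ### Transport along paths -/

/-- The map `F(a) → F(b)` induced by a path from `a` to `b`. -/
def transport (F : FundamentalGroupoid X ⥤ Type w) {a b : X} (γ : Path a b)
    (y : F.obj ⟨a⟩) : F.obj ⟨b⟩ :=
  F.map (FundamentalGroupoid.fromPath (Path.Homotopic.Quotient.mk γ)) y

section Transport

variable (F : FundamentalGroupoid X ⥤ Type w)

theorem transport_refl (a : X) (y : F.obj ⟨a⟩) : transport F (Path.refl a) y = y :=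
  F.map_id_apply (FundamentalGroupoid.mk a) y

theorem transport_trans {a b c : X} (γ : Path a b) (δ : Path b c) (y : F.obj ⟨a⟩) :
    transport F (γ.trans δ) y = transport F δ (transport F γ y) :=
  F.map_comp_apply (FundamentalGroupoid.fromPath (Path.Homotopic.Quotient.mk γ))
    (FundamentalGroupoid.fromPath (Path.Homotopic.Quotient.mk δ)) y

theorem transport_congr {a b : X} {γ γ' : Path a b} (h : γ.Homotopic γ') (y : F.obj ⟨a⟩) :
    transport F γ y = transport F γ' y := by
  unfold transport
  rw [(FundamentalGroupoid.fromPath_eq_iff_homotopic γ γ').2 h]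

theorem transport_symm_transport {a b : X} (γ : Path a b) (y : F.obj ⟨a⟩) :
    transport F γ.symm (transport F γ y) = y := by
  rw [← transport_trans, transport_congr F (Path.Homotopic.trans_symm γ), transport_refl]

theorem transport_transport_symm {a b : X} (γ : Path a b) (y : F.obj ⟨b⟩) :
    transport F γ (transport F γ.symm y) = y := by
  rw [← transport_trans, transport_congr F (Path.Homotopic.symm_trans γ), transport_refl]

theorem transport_injective {a b : X} (γ : Path a b) :
    Function.Injective (transport F γ) :=
  Function.LeftInverse.injective (transport_symm_transport F γ)

theorem transport_trans_symm_eq_iff {a b c : X} (γ : Path a b) (δ : Path c b)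
    (y : F.obj ⟨a⟩) (y' : F.obj ⟨c⟩) :
    transport F (γ.trans δ.symm) y = y' ↔ transport F γ y = transport F δ y' := by
  rw [transport_trans]
  constructor
  · rintro rfl
    rw [transport_transport_symm]
  · intro h
    rw [h, transport_symm_transport]

variable {F}

/-- Transport of a fixed point is locally constant on the space of paths with fixed endpoints. -/
theorem exists_isOpen_transport_const
    (hF : IsTopFunctor (fundamentalTau X) pointwiseTopology F) {a b : X} (γ₀ : Path a b)
    (y : F.obj ⟨a⟩) :
    ∃ U : Set C(I, X), IsOpen U ∧ γ₀.toContinuousMap ∈ U ∧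
      ∀ γ : Path a b, γ.toContinuousMap ∈ U → transport F γ y = transport F γ₀ y := by
  have h : Continuous[inferInstance, ⊥] fun γ : Path a b => transport F γ y := by
    -- `π^τ X` is coarser than `π^qtop X`, whose topology is the quotient of the path space.
    have h₁ := continuous_le_dom (le_tau (fundamentalQTop X) ⟨a⟩ ⟨b⟩) (hF ⟨a⟩ ⟨b⟩)
    have h₂ := continuous_induced_rng.1 (continuous_iInf_rng.1 h₁ y)
    exact continuous_coinduced_dom.1 h₂
  let : TopologicalSpace (F.obj ⟨b⟩) := ⊥
  have : DiscreteTopology (F.obj ⟨b⟩) := ⟨rfl⟩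
  obtain ⟨U, hU, hUeq⟩ := isOpen_induced_iff.1
    ((isOpen_discrete {transport F γ₀ y}).preimage h)
  have hmem (γ : Path a b) : γ.toContinuousMap ∈ U ↔ transport F γ y = transport F γ₀ y :=
    Set.ext_iff.1 hUeq γ
  exact ⟨U, hU, (hmem γ₀).2 rfl, fun γ => (hmem γ).1⟩

/-- Composition of `γ` with the inverse of `δ` is continuous in both paths, even when their common
endpoint varies. -/
theorem exists_isOpen_trans_symm_mem {a b c : X} (γ : Path a b) (δ : Path c b)
    {U : Set C(I, X)} (hU : IsOpen U) (h : (γ.trans δ.symm).toContinuousMap ∈ U) :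
    ∃ A B : Set C(I, X), IsOpen A ∧ IsOpen B ∧ γ.toContinuousMap ∈ A ∧ δ.toContinuousMap ∈ B ∧
      ∀ (b' : X) (γ' : Path a b') (δ' : Path c b'), γ'.toContinuousMap ∈ A →
        δ'.toContinuousMap ∈ B → (γ'.trans δ'.symm).toContinuousMap ∈ U := by
  let S : Set (C(I, X) × C(I, X)) := {q | q.1 0 = a ∧ q.2 0 = c ∧ q.1 1 = q.2 1}
  let P₁ (q : S) : Path a (q.1.1 1) := ⟨q.1.1, q.2.1, rfl⟩
  let P₂ (q : S) : Path c (q.1.1 1) := ⟨q.1.2, q.2.2.1, q.2.2.2.symm⟩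
  have h₁ : Continuous ↿P₁ := by
    change Continuous fun z : S × I => z.1.1.1 z.2
    fun_prop
  have h₂ : Continuous ↿P₂ := by
    change Continuous fun z : S × I => z.1.1.2 z.2
    fun_prop
  have hc : Continuous fun q : S => ((P₁ q).trans (P₂ q).symm).toContinuousMap :=
    ContinuousMap.continuous_of_continuous_uncurry _
      (Path.trans_continuous_family P₁ h₁ _ (Path.symm_continuous_family P₂ h₂))
  -- Replacing the endpoint `q.1.1 1` by a propositionally equal point does not change the map.
  have key (b' : X) (γ' : Path a b') (δ' : Path c b')
      (hq : γ'.toContinuousMap 0 = a ∧ δ'.toContinuousMap 0 = c ∧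
        γ'.toContinuousMap 1 = δ'.toContinuousMap 1) :
      ((P₁ ⟨(γ'.toContinuousMap, δ'.toContinuousMap), hq⟩).trans
        (P₂ ⟨(γ'.toContinuousMap, δ'.toContinuousMap), hq⟩).symm).toContinuousMap =
        (γ'.trans δ'.symm).toContinuousMap := by
    ext t
    rfl
  have hpt (b' : X) (γ' : Path a b') (δ' : Path c b') : γ'.toContinuousMap 0 = a ∧
      δ'.toContinuousMap 0 = c ∧ γ'.toContinuousMap 1 = δ'.toContinuousMap 1 :=
    ⟨γ'.source, δ'.source, γ'.target.trans δ'.target.symm⟩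
  obtain ⟨W, hW, hWeq⟩ := isOpen_induced_iff.1 (hU.preimage hc)
  have hmem (b' : X) (γ' : Path a b') (δ' : Path c b') :
      (γ'.toContinuousMap, δ'.toContinuousMap) ∈ W ↔ (γ'.trans δ'.symm).toContinuousMap ∈ U := by
    rw [← key b' γ' δ' (hpt b' γ' δ')]
    exact Set.ext_iff.1 hWeq ⟨(γ'.toContinuousMap, δ'.toContinuousMap), hpt b' γ' δ'⟩
  obtain ⟨A, B, hA, hB, hγ, hδ, hAB⟩ := isOpen_prod_iff.1 hW _ _ ((hmem b γ δ).2 h)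
  exact ⟨A, B, hA, hB, hγ, hδ, fun b' γ' δ' h₁ h₂ => (hmem b' γ' δ').1 (hAB ⟨h₁, h₂⟩)⟩

/-- If two points have the same transport along `γ` and `δ`, then also along all nearby paths with
a common, possibly different, endpoint. -/
theorem exists_isOpen_transport_eq
    (hF : IsTopFunctor (fundamentalTau X) pointwiseTopology F) {a b c : X} (γ : Path a b)
    (δ : Path c b) {y : F.obj ⟨a⟩} {y' : F.obj ⟨c⟩} (h : transport F γ y = transport F δ y') :
    ∃ A B : Set C(I, X), IsOpen A ∧ IsOpen B ∧ γ.toContinuousMap ∈ A ∧ δ.toContinuousMap ∈ B ∧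
      ∀ (b' : X) (γ' : Path a b') (δ' : Path c b'), γ'.toContinuousMap ∈ A →
        δ'.toContinuousMap ∈ B → transport F γ' y = transport F δ' y' := by
  obtain ⟨U, hU, hmem, hconst⟩ := exists_isOpen_transport_const hF (γ.trans δ.symm) y
  obtain ⟨A, B, hA, hB, hγ, hδ, hAB⟩ := exists_isOpen_trans_symm_mem γ δ hU hmem
  refine ⟨A, B, hA, hB, hγ, hδ, fun b' γ' δ' h₁ h₂ => ?_⟩
  rw [← transport_trans_symm_eq_iff, hconst _ (hAB b' γ' δ' h₁ h₂), transport_trans_symm_eq_iff]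
  exact h

end Transport

/-! ### The topology of the total space -/

section Topology

variable {F : FundamentalGroupoid X ⥤ Type w}

/-- The restriction of `Θ_F` to the summand `{y} × (𝒫X)_x`. -/
def thetaAt {x : X} (y : F.obj ⟨x⟩) (α : PathsFrom X x) : TildeSpace F :=
  Theta F ⟨x, y, α⟩

theorem thetaAt_of_path {x b : X} (y : F.obj ⟨x⟩) (β : Path x b) :
    thetaAt y ⟨β.toContinuousMap, β.source⟩ = ⟨b, transport F β y⟩ := by
  obtain ⟨β, rfl, rfl⟩ := β
  rfl

theorem thetaAt_const {x : X} (y : F.obj ⟨x⟩) :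
    thetaAt y ⟨ContinuousMap.const I x, rfl⟩ = ⟨x, y⟩ := by
  refine (thetaAt_of_path y (Path.refl x)).trans ?_
  rw [transport_refl]

theorem isOpen_iff_thetaAt {W : Set (TildeSpace F)} :
    IsOpen W ↔ ∀ (x : X) (y : F.obj ⟨x⟩), IsOpen (thetaAt y ⁻¹' W) := by
  let : ∀ x : X, TopologicalSpace (F.obj ⟨x⟩) := fun _ => ⊥
  have : ∀ x : X, DiscreteTopology (F.obj ⟨x⟩) := fun _ => ⟨rfl⟩
  refine isOpen_coinduced.trans (isOpen_sigma_iff.trans (forall_congr' fun x => ?_))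
  refine continuous_Prop.symm.trans (continuous_prod_of_discrete_left.trans ?_)
  exact forall_congr' fun y => continuous_Prop

theorem continuous_thetaAt {x : X} (y : F.obj ⟨x⟩) : Continuous (thetaAt y) :=
  continuous_def.2 fun _ hW => isOpen_iff_thetaAt.1 hW x y

/-- A set `W` is open if, whenever transport along a path leads into `W`, so does transport of the
same point along all nearby paths with the same starting point. -/
theorem isOpen_of_forall_path {W : Set (TildeSpace F)}
    (h : ∀ (x b : X) (y : F.obj ⟨x⟩) (γ : Path x b), (⟨b, transport F γ y⟩ : TildeSpace F) ∈ W →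
      ∃ A : Set C(I, X), IsOpen A ∧ γ.toContinuousMap ∈ A ∧
        ∀ (b' : X) (γ' : Path x b'), γ'.toContinuousMap ∈ A →
          (⟨b', transport F γ' y⟩ : TildeSpace F) ∈ W) :
    IsOpen W := by
  refine isOpen_iff_thetaAt.2 fun x y => isOpen_iff_mem_nhds.2 fun α hα => ?_
  obtain ⟨A, hA, hαA, hAW⟩ := h x (α.1 1) y ⟨α.1, α.2, rfl⟩ hα
  filter_upwards [(hA.preimage continuous_subtype_val).mem_nhds hαA] with α' hα'
  exact hAW _ ⟨α'.1, α'.2, rfl⟩ hα'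

theorem exists_isOpen_of_path {W : Set (TildeSpace F)} (hW : IsOpen W) {x b : X} {y : F.obj ⟨x⟩}
    (γ : Path x b) (h : (⟨b, transport F γ y⟩ : TildeSpace F) ∈ W) :
    ∃ A : Set C(I, X), IsOpen A ∧ γ.toContinuousMap ∈ A ∧
      ∀ (b' : X) (γ' : Path x b'), γ'.toContinuousMap ∈ A →
        (⟨b', transport F γ' y⟩ : TildeSpace F) ∈ W := by
  obtain ⟨A, hA, hAeq⟩ := isOpen_induced_iff.1 (isOpen_iff_thetaAt.1 hW x y)
  have hmem (b' : X) (γ' : Path x b') :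
      γ'.toContinuousMap ∈ A ↔ (⟨b', transport F γ' y⟩ : TildeSpace F) ∈ W := by
    rw [← thetaAt_of_path]
    exact Set.ext_iff.1 hAeq ⟨γ'.toContinuousMap, γ'.source⟩
  exact ⟨A, hA, (hmem b γ).2 h, fun b' γ' => (hmem b' γ').1⟩

end Topology

/-! ### Sheets over small open sets -/

section Sheets

variable {F : FundamentalGroupoid X ⥤ Type w}

/-- The points over `V` obtained by transporting `y` along paths in `U`. -/
def sheet {x₀ : X} (y : F.obj ⟨x₀⟩) (U : Set C(I, X)) (V : Set X) : Set (TildeSpace F) :=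
  {z | z.1 ∈ V ∧ ∃ β : Path x₀ z.1, β.toContinuousMap ∈ U ∧ transport F β y = z.2}

/-- Transport of `y` along a path in `U` depends on the endpoint of the path only. -/
def IsSmallFor {x₀ : X} (y : F.obj ⟨x₀⟩) (U : Set C(I, X)) : Prop :=
  ∀ (b : X) (β β' : Path x₀ b), β.toContinuousMap ∈ U → β'.toContinuousMap ∈ U →
    transport F β y = transport F β' y

theorem IsSmallFor.mono {x₀ : X} {y : F.obj ⟨x₀⟩} {U U' : Set C(I, X)} (h : IsSmallFor y U)
    (hU : U' ⊆ U) : IsSmallFor y U' :=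
  fun b β β' hβ hβ' => h b β β' (hU hβ) (hU hβ')

theorem exists_isOpen_isSmallFor
    (hF : IsTopFunctor (fundamentalTau X) pointwiseTopology F) {x₀ x : X} (α : Path x₀ x)
    (y : F.obj ⟨x₀⟩) :
    ∃ U : Set C(I, X), IsOpen U ∧ α.toContinuousMap ∈ U ∧ IsSmallFor y U := by
  obtain ⟨A, B, hA, hB, hαA, hαB, h⟩ :=
    exists_isOpen_transport_eq hF α α (rfl : transport F α y = transport F α y)
  exact ⟨A ∩ B, hA.inter hB, ⟨hαA, hαB⟩, fun b β β' hβ hβ' => h b β β' hβ.1 hβ'.2⟩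

theorem IsSmallFor.injOn_sheet {x₀ : X} {y : F.obj ⟨x₀⟩} {U : Set C(I, X)} (h : IsSmallFor y U)
    (V : Set X) : Set.InjOn (tildeProj F) (sheet y U V) := by
  rintro ⟨b, z⟩ ⟨-, β, hβ, hz⟩ ⟨b', z'⟩ ⟨-, β', hβ', hz'⟩ (rfl : b = b')
  exact congrArg (Sigma.mk b) (hz.symm.trans ((h b β β' hβ hβ').trans hz'))

theorem IsSmallFor.disjoint_sheet {x₀ : X} {y y' : F.obj ⟨x₀⟩} {U : Set C(I, X)}
    (h : IsSmallFor y U) (hy : y ≠ y') (V : Set X) :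
    Disjoint (sheet y U V) (sheet y' U V) := by
  refine Set.disjoint_left.2 ?_
  rintro ⟨b, z⟩ ⟨-, β, hβ, hz⟩ ⟨-, β', hβ', hz'⟩
  exact hy (transport_injective F β' ((h b β' β hβ' hβ).trans (hz.trans hz'.symm)))

theorem IsSmallFor.isOpen_sheet (hF : IsTopFunctor (fundamentalTau X) pointwiseTopology F)
    {x₀ : X} {y : F.obj ⟨x₀⟩} {U : Set C(I, X)} (h : IsSmallFor y U) (hU : IsOpen U)
    {V : Set X} (hV : IsOpen V)
    (hwell : ∀ b ∈ V, ∃ β : Path x₀ b, β.toContinuousMap ∈ U ∧ IsWellEnded β.toContinuousMap) :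
    IsOpen (sheet y U V) := by
  refine isOpen_of_forall_path ?_
  rintro x₁ b y₁ γ ⟨hb : b ∈ V, β', hβ', hγ : transport F β' y = transport F γ y₁⟩
  obtain ⟨β, hβU, hβ⟩ := hwell b hb
  obtain ⟨A, B, hA, hB, hγA, hβB, hAB⟩ :=
    exists_isOpen_transport_eq hF γ β (hγ.symm.trans (h b β' β hβ' hβU))
  -- The well-ended path `β` can be followed by paths in `U ∩ B` to all points near `b`.
  obtain ⟨V₀, V₁, -, hV₁, hβ₀, hβ₁, hβV⟩ := hβ (U ∩ B) (hU.inter hB) ⟨hβU, hβB⟩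
  have hx₀ : x₀ ∈ V₀ := β.source ▸ hβ₀
  have hb₁ : b ∈ V₁ := β.target ▸ hβ₁
  refine ⟨A ∩ (fun α : C(I, X) => α 1) ⁻¹' (V ∩ V₁),
    hA.inter ((hV.inter hV₁).preimage (continuous_eval_const 1)), ⟨hγA, ?_⟩, ?_⟩
  · change γ 1 ∈ V ∩ V₁
    rw [γ.target]
    exact ⟨hb, hb₁⟩
  · rintro b' γ' ⟨hγ'A, hγ'V⟩
    replace hγ'V : b' ∈ V ∩ V₁ := γ'.target ▸ hγ'V
    obtain ⟨δ, hδ, hδ₀, hδ₁⟩ := hβV x₀ hx₀ b' hγ'V.2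
    exact ⟨hγ'V.1, ⟨δ, hδ₀, hδ₁⟩, hδ.1, (hAB b' γ' ⟨δ, hδ₀, hδ₁⟩ hγ'A hδ.2).symm⟩

/-- Over a neighborhood of the endpoint of a locally well-ended path, small sheets are open. -/
theorem exists_isOpen_sheet
    (hF : IsTopFunctor (fundamentalTau X) pointwiseTopology F)
    {x₀ x : X} (α : Path x₀ x) (hα : IsLocallyWellEnded α.toContinuousMap)
    {U : Set C(I, X)} (hU : IsOpen U) (hαU : α.toContinuousMap ∈ U) :
    ∃ V : Set X, x ∈ V ∧ ∀ y : F.obj ⟨x₀⟩, IsSmallFor y U → IsOpen (sheet y U V) := by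
  obtain ⟨V₀, V₁, -, hV₁, hα₀, hα₁, hV⟩ := hα U hU hαU
  refine ⟨V₁, α.target ▸ hα₁, fun y hy => hy.isOpen_sheet hF hU hV₁ fun b hb => ?_⟩
  obtain ⟨β, hβU, hβ, hβ₀, hβ₁⟩ := hV x₀ (α.source ▸ hα₀) b hb
  exact ⟨⟨β, hβ₀, hβ₁⟩, hβU, hβ⟩

end Sheets

/-! ### Local properties of the projection -/

section Projection

variable {F : FundamentalGroupoid X ⥤ Type w}

theorem IsLocallyWepConnected.exists_path (hX : IsLocallyWepConnected X) (x₀ x₁ : X) :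
    ∃ α : Path x₀ x₁, IsLocallyWellEnded α.toContinuousMap := by
  obtain ⟨α, hα, h₀, h₁⟩ := hX x₀ x₁
  exact ⟨⟨α, h₀, h₁⟩, hα⟩

theorem IsLocallyWellEnded.isWellEnded {α : C(I, X)} (hα : IsLocallyWellEnded α) :
    IsWellEnded α := by
  intro U hU hαU
  obtain ⟨V₀, V₁, hV₀, hV₁, h₀, h₁, h⟩ := hα U hU hαU
  refine ⟨V₀, V₁, hV₀, hV₁, h₀, h₁, fun a ha b hb => ?_⟩
  obtain ⟨β, hβU, -, hβ⟩ := h a ha b hb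
  exact ⟨β, hβU, hβ⟩

theorem isLocallyInjective_tildeProj (hX : IsLocallyWepConnected X)
    (hF : IsTopFunctor (fundamentalTau X) pointwiseTopology F) :
    IsLocallyInjective (tildeProj F) := by
  rintro ⟨x, z⟩
  obtain ⟨α, hα⟩ := hX.exists_path x x
  obtain ⟨U, hU, hαU, hsmall⟩ := exists_isOpen_isSmallFor hF α (transport F α.symm z)
  obtain ⟨V, hxV, hV⟩ := exists_isOpen_sheet hF α hα hU hαU
  exact ⟨_, hV _ hsmall, ⟨hxV, α, hαU, transport_transport_symm F α z⟩, hsmall.injOn_sheet V⟩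

theorem isSeparatedMap_tildeProj (hX : IsLocallyWepConnected X)
    (hF : IsTopFunctor (fundamentalTau X) pointwiseTopology F) :
    IsSeparatedMap (tildeProj F) := by
  rintro ⟨x, z⟩ ⟨x', z'⟩ (rfl : x = x') hne
  obtain ⟨α, hα⟩ := hX.exists_path x x
  obtain ⟨U, hU, hαU, hsmall⟩ := exists_isOpen_isSmallFor hF α (transport F α.symm z)
  obtain ⟨U', hU', hαU', hsmall'⟩ := exists_isOpen_isSmallFor hF α (transport F α.symm z')
  obtain ⟨V, hxV, hV⟩ := exists_isOpen_sheet hF α hα (hU.inter hU') ⟨hαU, hαU'⟩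
  have hy : transport F α.symm z ≠ transport F α.symm z' := fun h =>
    hne (congrArg (Sigma.mk x) (transport_injective F α.symm h))
  exact ⟨_, _, hV _ (hsmall.mono Set.inter_subset_left), hV _ (hsmall'.mono Set.inter_subset_right),
    ⟨hxV, α, ⟨hαU, hαU'⟩, transport_transport_symm F α z⟩,
    ⟨hxV, α, ⟨hαU, hαU'⟩, transport_transport_symm F α z'⟩,
    (hsmall.mono Set.inter_subset_left).disjoint_sheet hy V⟩

theorem isOpenMap_tildeProj (hX : IsLocallyWepConnected X) : IsOpenMap (tildeProj F) := by
  refine fun W hW => isOpen_iff_mem_nhds.2 ?_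
  rintro _ ⟨⟨x, z⟩, hz, rfl⟩
  obtain ⟨α, hα⟩ := hX.exists_path x x
  rw [← transport_transport_symm F α z] at hz
  obtain ⟨A, hA, hαA, hAW⟩ := exists_isOpen_of_path hW α hz
  obtain ⟨V₀, V₁, -, hV₁, hα₀, hα₁, h⟩ := hα.isWellEnded A hA hαA
  have hxV : x ∈ V₁ := α.target ▸ hα₁
  refine Filter.mem_of_superset (hV₁.mem_nhds hxV) fun b hb => ?_
  obtain ⟨β, hβA, hβ₀, hβ₁⟩ := h x (α.source ▸ hα₀) b hb
  exact ⟨_, hAW b ⟨β, hβ₀, hβ₁⟩ hβA, rfl⟩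

theorem isLocalHomeomorph_tildeProj (hX : IsLocallyWepConnected X)
    (hF : IsTopFunctor (fundamentalTau X) pointwiseTopology F) :
    IsLocalHomeomorph (tildeProj F) := by
  refine isLocalHomeomorph_iff_isOpenEmbedding_restrict.2 fun z => ?_
  obtain ⟨W, hW, hzW, hinj⟩ := isLocallyInjective_tildeProj hX hF z
  exact ⟨W, hW.mem_nhds hzW, .of_continuous_injective_isOpenMap
    ((tildeProj F).continuous.comp continuous_subtype_val) hinj.injective
    ((isOpenMap_tildeProj hX).comp hW.isOpenMap_subtype_val)⟩

end Projection

/-! ### Lifting of paths and homotopies -/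

section Lifting

variable {F : FundamentalGroupoid X ⥤ Type w}

theorem eq_of_tildeProj_comp_eq (hX : IsLocallyWepConnected X)
    (hF : IsTopFunctor (fundamentalTau X) pointwiseTopology F) {T : Type*} [TopologicalSpace T]
    [PreconnectedSpace T] {f g : C(T, TildeSpace F)} (t : T) (ht : f t = g t)
    (h : (tildeProj F).comp f = (tildeProj F).comp g) : f = g :=
  DFunLike.coe_injective <| (isSeparatedMap_tildeProj hX hF).eq_of_comp_eq
    (isLocallyInjective_tildeProj hX hF) f.continuous g.continuous
    (congrArg DFunLike.coe h) t ht

/-- The path `s ↦ α(st)`, the initial segment of `α` up to time `t`. -/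
def initialSegment {x : X} (α : PathsFrom X x) (t : I) : PathsFrom X x :=
  ⟨⟨fun s => α.1 (s * t), by fun_prop⟩, by simpa using α.2⟩

theorem continuous_initialSegment {x : X} :
    Continuous fun q : PathsFrom X x × I => initialSegment q.1 q.2 := by
  refine Continuous.subtype_mk (ContinuousMap.continuous_of_continuous_uncurry _ ?_) _
  change Continuous fun z : (PathsFrom X x × I) × I => z.1.1.1 (z.2 * z.1.2)
  fun_prop

theorem hasContinuousLiftingOfPaths_tildeProj (hX : IsLocallyWepConnected X)
    (hF : IsTopFunctor (fundamentalTau X) pointwiseTopology F) :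
    HasContinuousLiftingOfPaths (tildeProj F) := by
  rintro ⟨x, y⟩
  have hθ : Continuous fun q : PathsFrom X x × I => thetaAt y (initialSegment q.1 q.2) :=
    (continuous_thetaAt y).comp continuous_initialSegment
  let L (α : PathsFrom X x) : PathsFrom (TildeSpace F) ⟨x, y⟩ :=
    ⟨⟨fun t => thetaAt y (initialSegment α t), hθ.comp (.prodMk_right α)⟩, by
      have : initialSegment α 0 = ⟨ContinuousMap.const I x, rfl⟩ := by
        ext s
        simpa [initialSegment] using α.2
      change thetaAt y (initialSegment α 0) = _
      rw [this, thetaAt_const]⟩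
  have hL : Continuous L :=
    Continuous.subtype_mk (ContinuousMap.continuous_of_continuous_uncurry _ hθ) _
  have hright : Function.RightInverse L (pathsFromMap (tildeProj F) ⟨x, y⟩) := by
    intro α
    ext t
    change α.1 (1 * t) = α.1 t
    rw [one_mul]
  have hcont : Continuous (pathsFromMap (tildeProj F) ⟨x, y⟩) :=
    Continuous.subtype_mk
      ((ContinuousMap.continuous_postcomp _).comp continuous_subtype_val) _
  refine isHomeomorph_iff_exists_inverse.2 ⟨hcont, L, fun β => ?_, hright, hL⟩
  exact Subtype.ext (eq_of_tildeProj_comp_eq hX hF 0 ((L _).2.trans β.2.symm)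
    (congrArg Subtype.val (hright (pathsFromMap (tildeProj F) ⟨x, y⟩ β))))

/-- The point `(us, t)` of the simplex on the horizontal segment from `(0, t)` to `(s, t)`. -/
def Simplex2.scale (q : Simplex2) (u : I) : Simplex2 :=
  ⟨(u * q.1.1, q.1.2), 
    (add_le_add_left (Subtype.coe_le_coe.2 unitInterval.mul_le_right) _).trans q.2⟩

theorem Simplex2.continuous_scale : Continuous fun z : Simplex2 × I => z.1.scale z.2 :=
  Continuous.subtype_mk (by fun_prop) _

/-- The path `u ↦ φ(us, t)` from the collapsed edge of `φ` to `φ(s, t)`, where `q = (s, t)`. -/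
def horizontalPath {x : X} (φ : HomotopiesFrom X x) (q : Simplex2) : PathsFrom X x :=
  ⟨⟨fun u => φ.1 (q.scale u),
    φ.1.continuous.comp (Simplex2.continuous_scale.comp (.prodMk_right q))⟩,
    φ.2 _ (zero_mul _)⟩

instance : CompactSpace Simplex2 :=
  isCompact_iff_compactSpace.1 (IsClosed.isCompact
    (isClosed_le (f := fun q : I × I => (q.1 : ℝ) + (q.2 : ℝ)) (by fun_prop) continuous_const))

instance : PathConnectedSpace Simplex2 := by
  -- The simplex is star-shaped about its vertex `(0, 0)`.
  have h (q : Simplex2) : Joined (⟨(0, 0), by simp⟩ : Simplex2) q :=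
    ⟨{ toFun := fun u => ⟨(u * q.1.1, u * q.1.2), (add_le_add
        (Subtype.coe_le_coe.2 unitInterval.mul_le_right)
        (Subtype.coe_le_coe.2 unitInterval.mul_le_right)).trans q.2⟩
       continuous_toFun := Continuous.subtype_mk (by fun_prop) _
       source' := by simp
       target' := by simp }⟩
  exact ⟨⟨⟨(0, 0), by simp⟩⟩, fun p q => (h p).symm.trans (h q)⟩

theorem continuous_horizontalPath {x : X} :
    Continuous fun z : HomotopiesFrom X x × Simplex2 => horizontalPath z.1 z.2 := by
  refine Continuous.subtype_mk (ContinuousMap.continuous_of_continuous_uncurry _ ?_) _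
  change Continuous fun z : (HomotopiesFrom X x × Simplex2) × I => z.1.1.1 (z.1.2.scale z.2)
  have : Continuous fun z : (HomotopiesFrom X x × Simplex2) × I => z.1.2.scale z.2 :=
    Simplex2.continuous_scale.comp (by fun_prop : Continuous
      fun z : (HomotopiesFrom X x × Simplex2) × I => (z.1.2, z.2))
  fun_prop

theorem hasContinuousLiftingOfHomotopies_tildeProj (hX : IsLocallyWepConnected X)
    (hF : IsTopFunctor (fundamentalTau X) pointwiseTopology F) :
    HasContinuousLiftingOfHomotopies (tildeProj F) := by
  rintro ⟨x, y⟩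
  have hθ : Continuous fun z : HomotopiesFrom X x × Simplex2 => thetaAt y (horizontalPath z.1 z.2) :=
    (continuous_thetaAt y).comp continuous_horizontalPath
  let L (φ : HomotopiesFrom X x) : HomotopiesFrom (TildeSpace F) ⟨x, y⟩ :=
    ⟨⟨fun q => thetaAt y (horizontalPath φ q), hθ.comp (.prodMk_right φ)⟩, by
      intro q hq
      have : horizontalPath φ q = ⟨ContinuousMap.const I x, rfl⟩ := by
        ext u
        exact φ.2 _ (by simp [Simplex2.scale, hq])
      change thetaAt y (horizontalPath φ q) = _
      rw [this, thetaAt_const]⟩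
  have hL : Continuous L :=
    Continuous.subtype_mk (ContinuousMap.continuous_of_continuous_uncurry _ hθ) _
  have hright : Function.RightInverse L (homotopiesFromMap (tildeProj F) ⟨x, y⟩) := by
    intro φ
    ext q
    change φ.1 (q.scale 1) = φ.1 q
    congr 1
    exact Subtype.ext (Prod.ext (one_mul _) rfl)
  have hcont : Continuous (homotopiesFromMap (tildeProj F) ⟨x, y⟩) :=
    Continuous.subtype_mk
      ((ContinuousMap.continuous_postcomp _).comp continuous_subtype_val) _
  refine isHomeomorph_iff_exists_inverse.2 ⟨hcont, L, fun ψ => ?_, hright, hL⟩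
  let o : Simplex2 := ⟨(0, 0), by simp⟩
  exact Subtype.ext (eq_of_tildeProj_comp_eq hX hF o (((L _).2 o rfl).trans (ψ.2 o rfl).symm)
    (congrArg Subtype.val (hright (homotopiesFromMap (tildeProj F) ⟨x, y⟩ ψ))))

end Lifting

end

end SemicoveringTheory

theorem mainTheorem2 {X : Type u} [TopologicalSpace X]
    (hX : SemicoveringTheory.IsLocallyWepConnected X)
    (F : FundamentalGroupoid X ⥤ Type w)
    (hF : SemicoveringTheory.IsTopFunctor (SemicoveringTheory.fundamentalTau X)
      SemicoveringTheory.pointwiseTopology F) :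
    SemicoveringTheory.IsSemicoveringMap (SemicoveringTheory.tildeProj F) where
  isLocalHomeomorph := SemicoveringTheory.isLocalHomeomorph_tildeProj hX hF
  liftingOfPaths := SemicoveringTheory.hasContinuousLiftingOfPaths_tildeProj hX hF
  liftingOfHomotopies := SemicoveringTheory.hasContinuousLiftingOfHomotopies_tildeProj hX hF
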